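/- Let $(M,g)$ be a smooth Riemannian manifold with Levi-Civita connection $\nabla$, carrying an $f$-structure $F$, i.e. a smooth $g$-skew-symmetric section $F$ of $\mathrm{End}(TM)$ with $F^3+F=0$. Let $T^{+}M,\,T^{-}M,\,T^{0}M\subset T^{\mathbb C}M$ be the eigenspaces of (the complex-linear extension of) $F$ for the eigenvalues $+i,\,-i,\,0$ (the vectors of type $+,-,0$), and let $T^{*+}M,\,T^{*-}M$ be the bundles of complex covectors $\theta$ with $\theta\circ F=i\theta$, respectively $\theta\circ F=-i\theta$. Let $\omega(X,Y)=g(X,FY)$ be the fundamental 2-form. Suppose that 1. $F$ is integrable: around each point of $M$ there are local coordinates in which $F$ has the constant components $\begin{pmatrix}0&-\mathrm{Id}_m&0\\ \mathrm{Id}_m&0&0\\ 0&0&0\end{pmatrix}$ for some $m$; 2. $\nabla_{T^{0}M}(T^{*+}M)\subseteq T^{*+}M+T^{*-}M$, i.e. for every smooth local section $\theta$ of $T^{*+}M$ and every $X\in T^0M$ (over its domain), $\nabla_X\theta\in T^{*+}M+T^{*-}M$; 3. $d\omega^{(1,2)}=0$, i.e. $d\omega(u,v,w)=0$ whenever $u,v$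 are complex tangent vectors of the same type ($+$, $-$ or $0$) and $w$ is of a different type. Let $(N,J,h)$ be a Kähler manifold. Then every smooth map $\phi:M\to N$ that is $f$-holomorphic, i.e. satisfies $d\phi\circ F=J\circ d\phi$, is harmonic, i.e. its tension field $\tau(\phi)=\mathrm{trace}_g\nabla d\phi$ vanishes identically. -/

import Mathlib

set_option maxSynthPendingDepth 3

open scoped Manifold ContDiff TensorProduct
open Bundle

noncomputable section

namespace FStr

/-! ### Multilinear algebra -/

section Algebra

variable {V : Type*} [NormedAddCommGroup V] [NormedSpace ℝ V]

/-- The trilinear form `(u, v, w) ↦ A w u v`. -/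
def rotate (A : V →L[ℝ] V →L[ℝ] V →L[ℝ] ℝ) : V →L[ℝ] V →L[ℝ] V →L[ℝ] ℝ :=
  (ContinuousLinearMap.flipₗᵢ ℝ V V ℝ : (V →L[ℝ] V →L[ℝ] ℝ) →L[ℝ] (V →L[ℝ] V →L[ℝ] ℝ)).comp A.flip

@[simp] theorem rotate_apply (A : V →L[ℝ] V →L[ℝ] V →L[ℝ] ℝ) (u v w : V) :
    rotate A u v w = A w u v := rfl

end Algebra

section Complexify

variable {V : Type*} [AddCommGroup V] [Module ℝ V]

/-- Complex-linear extension of real-linear maps with values in a complex vector space. -/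
def cLift (W : Type*) [AddCommGroup W] [Module ℝ W] [Module ℂ W] [IsScalarTower ℝ ℂ W] :
    (V →ₗ[ℝ] W) →ₗ[ℝ] ((ℂ ⊗[ℝ] V) →ₗ[ℂ] W) :=
  ((LinearMap.liftBaseChangeEquiv ℂ).toLinearMap).restrictScalars ℝ

/-- The complex-trilinear extension of a real trilinear form to the complexification `ℂ ⊗ V`. -/
def cTrilinear : (V →ₗ[ℝ] V →ₗ[ℝ] V →ₗ[ℝ] ℝ) →ₗ[ℝ]
    ((ℂ ⊗[ℝ] V) →ₗ[ℂ] (ℂ ⊗[ℝ] V) →ₗ[ℂ] (ℂ ⊗[ℝ] V) →ₗ[ℂ] ℂ) :=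
  let c₁ : (V →ₗ[ℝ] ℝ) →ₗ[ℝ] ((ℂ ⊗[ℝ] V) →ₗ[ℂ] ℂ) :=
    cLift ℂ ∘ₗ LinearMap.compRight ℝ Complex.ofRealCLM.toLinearMap
  let c₂ : (V →ₗ[ℝ] V →ₗ[ℝ] ℝ) →ₗ[ℝ] ((ℂ ⊗[ℝ] V) →ₗ[ℂ] (ℂ ⊗[ℝ] V) →ₗ[ℂ] ℂ) :=
    cLift _ ∘ₗ LinearMap.compRight ℝ c₁
  cLift _ ∘ₗ LinearMap.compRight ℝ c₂

@[simp] theorem cTrilinear_tmul (T : V →ₗ[ℝ] V →ₗ[ℝ] V →ₗ[ℝ] ℝ) (a b c : ℂ) (u v w : V) :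
    cTrilinear T (a ⊗ₜ u) (b ⊗ₜ v) (c ⊗ₜ w) = a * b * c * (T u v w : ℝ) := by
  simp [cTrilinear, cLift, mul_assoc]

end Complexify

/-- The three types `+`, `-`, `0`. -/
inductive FType
  | plus
  | minus
  | zero

/-- The eigenvalue `i`, `-i`, `0` belonging to each type. -/
def FType.eigenvalue : FType → ℂ
  | .plus => Complex.I
  | .minus => -Complex.I
  | .zero => 0

/-! ### Riemannian metrics and tensors in charts -/

section Geometry

variable {E : Type*} [NormedAddCommGroup E] [NormedSpace ℝ E]
variable {M : Type*} [TopologicalSpace M] [ChartedSpace E M]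

/-- The tangent space at `x` of a manifold without boundary modelled on the real vector space `E`. -/
abbrev Tan (E : Type*) [NormedAddCommGroup E] [NormedSpace ℝ E]
    {M : Type*} [TopologicalSpace M] [ChartedSpace E M] (x : M) : Type _ :=
  TangentSpace 𝓘(ℝ, E) x

/-- Smooth Riemannian metrics on `M`. -/
abbrev Metric (E : Type*) [NormedAddCommGroup E] [NormedSpace ℝ E]
    (M : Type*) [TopologicalSpace M] [ChartedSpace E M] [IsManifold 𝓘(ℝ, E) ∞ M] :=
  ContMDiffRiemannianMetric 𝓘(ℝ, E) ∞ E (fun x : M => Tan E x)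

/-- (Not necessarily smooth) sections of `End(TM)`. -/
abbrev EndField (E : Type*) [NormedAddCommGroup E] [NormedSpace ℝ E]
    (M : Type*) [TopologicalSpace M] [ChartedSpace E M] :=
  ∀ x : M, Tan E x →L[ℝ] Tan E x

/-- Sections of `T*M ⊗ T*M`. -/
abbrev BilinField (E : Type*) [NormedAddCommGroup E] [NormedSpace ℝ E]
    (M : Type*) [TopologicalSpace M] [ChartedSpace E M] :=
  ∀ x : M, Tan E x →L[ℝ] Tan E x →L[ℝ] ℝ

/-- Complex 1-forms: sections of `Hom_ℝ(TM, ℂ)`, the dual of the complexified tangent bundle. -/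
abbrev CForm (E : Type*) [NormedAddCommGroup E] [NormedSpace ℝ E]
    (M : Type*) [TopologicalSpace M] [ChartedSpace E M] :=
  ∀ x : M, Tan E x →L[ℝ] ℂ

/-- The smooth charts of `M`. -/
abbrev Charts (E : Type*) [NormedAddCommGroup E] [NormedSpace ℝ E]
    (M : Type*) [TopologicalSpace M] [ChartedSpace E M] : Set (OpenPartialHomeomorph M E) :=
  IsManifold.maximalAtlas 𝓘(ℝ, E) ∞ M

/-- The differential of the chart `e` at `x`: coordinates of tangent vectors. -/
def toCoord (e : OpenPartialHomeomorph M E) (x : M) : Tan E x →L[ℝ] E :=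
  mfderiv 𝓘(ℝ, E) 𝓘(ℝ, E) e x

/-- The differential of the inverse of the chart `e` at the coordinate point `p`. It maps a
vector `u` of `E` to the value of the coordinate vector field `∂_u`. -/
def ofCoord (e : OpenPartialHomeomorph M E) (p : E) : E →L[ℝ] Tan E (e.symm p) :=
  mfderiv 𝓘(ℝ, E) 𝓘(ℝ, E) e.symm p

/-- The coordinate expression of a bilinear form field in the chart `e`. -/
def localBilin (b : BilinField E M) (e : OpenPartialHomeomorph M E) (p : E) : E →L[ℝ] E →L[ℝ] ℝ :=
  ContinuousLinearMap.bilinearComp (E := E) (F := E) (b (e.symm p)) (ofCoord e p) (ofCoord e p)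

theorem localBilin_apply (b : BilinField E M) (e : OpenPartialHomeomorph M E) (p u v : E) :
    localBilin b e p u v = b (e.symm p) (ofCoord e p u) (ofCoord e p v) := rfl

/-- The coordinate expression of a complex 1-form in the chart `e`. -/
def localForm (θ : CForm E M) (e : OpenPartialHomeomorph M E) (p : E) : E →L[ℝ] ℂ :=
  (θ (e.symm p)).comp (ofCoord e p)

/-- The exterior derivative of a 2-form, in the chart `e` at the coordinate point `p`:
`dβ(u, v, w) = ∂_u β(v, w) - ∂_v β(u, w) + ∂_w β(u, v)` for coordinate fields `u, v, w`. -/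
def localExtDeriv (β : BilinField E M) (e : OpenPartialHomeomorph M E) (p : E) :
    E →L[ℝ] E →L[ℝ] E →L[ℝ] ℝ :=
  let A : E →L[ℝ] E →L[ℝ] E →L[ℝ] ℝ := fderiv ℝ (localBilin β e) p
  A - A.flip + rotate A

theorem localExtDeriv_apply (β : BilinField E M) (e : OpenPartialHomeomorph M E) (p u v w : E) :
    localExtDeriv β e p u v w = fderiv ℝ (localBilin β e) p u v w
      - fderiv ℝ (localBilin β e) p v u w + fderiv ℝ (localBilin β e) p w u v := rfl

/-- The exterior derivative of a 2-form at `x`, as a trilinear form on the tangent space at `x`,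
computed in the chart `e`. -/
def extDerivAt (β : BilinField E M) (e : OpenPartialHomeomorph M E) (x : M) :
    Tan E x →ₗ[ℝ] Tan E x →ₗ[ℝ] Tan E x →ₗ[ℝ] ℝ :=
  let c : Tan E x →ₗ[ℝ] E := (toCoord e x).toLinearMap
  LinearMap.mk₂ ℝ (fun u v => (localExtDeriv β e (e x) (c u) (c v)).toLinearMap ∘ₗ c)
    (by intros; ext; simp) (by intros; ext; simp) (by intros; ext; simp) (by intros; ext; simp)

theorem extDerivAt_apply (β : BilinField E M) (e : OpenPartialHomeomorph M E) (x : M)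
    (u v w : Tan E x) : extDerivAt β e x u v w =
      localExtDeriv β e (e x) (toCoord e x u) (toCoord e x v) (toCoord e x w) := rfl

variable [IsManifold 𝓘(ℝ, E) ∞ M]

/-- The coordinate expression of a Riemannian metric in the chart `e`. -/
def localMetric (g : Metric E M) (e : OpenPartialHomeomorph M E) (p : E) : E →L[ℝ] E →L[ℝ] ℝ :=
  localBilin g.inner e p

/-- Raising an index with the metric: the inverse `E* → E` of `u ↦ g(u, ·)`. -/
def sharp (g : Metric E M) (e : OpenPartialHomeomorph M E) (p : E) : (E →L[ℝ] ℝ) →L[ℝ] E :=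
  (localMetric g e p).inverse

/-- The Christoffel symbols of the first kind in the chart `e`. -/
def christoffelFirst (g : Metric E M) (e : OpenPartialHomeomorph M E) (p : E) :
    E →L[ℝ] E →L[ℝ] E →L[ℝ] ℝ :=
  let A : E →L[ℝ] E →L[ℝ] E →L[ℝ] ℝ := fderiv ℝ (localMetric g e) p
  (2⁻¹ : ℝ) • (A + A.flip - rotate A)

theorem christoffelFirst_apply (g : Metric E M) (e : OpenPartialHomeomorph M E) (p u v w : E) :
    christoffelFirst g e p u v w = 2⁻¹ * (fderiv ℝ (localMetric g e) p u v w
      + fderiv ℝ (localMetric g e) p v u w - fderiv ℝ (localMetric g e) p w u v) := rfl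

/-- The Christoffel symbols `Γ(u, v) = ∇_u ∂_v` of the Levi-Civita connection in the chart `e`. -/
def christoffel (g : Metric E M) (e : OpenPartialHomeomorph M E) (p : E) : E →L[ℝ] E →L[ℝ] E :=
  (ContinuousLinearMap.compL ℝ E (E →L[ℝ] ℝ) E (sharp g e p)).comp (christoffelFirst g e p)

theorem christoffel_apply (g : Metric E M) (e : OpenPartialHomeomorph M E) (p u v : E) :
    christoffel g e p u v = sharp g e p (christoffelFirst g e p u v) := rfl

/-- The covariant derivative of a complex 1-form in the chart `e`:
`(∇_u θ)(v) = ∂_u (θ(v)) - θ(Γ(u, v))` for coordinate fields `u, v`. -/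
def localNabla (g : Metric E M) (θ : CForm E M) (e : OpenPartialHomeomorph M E) (p : E) :
    E →L[ℝ] E →L[ℝ] ℂ :=
  fderiv ℝ (localForm θ e) p
    - (ContinuousLinearMap.compL ℝ E E ℂ (localForm θ e p)).comp (christoffel g e p)

theorem localNabla_apply (g : Metric E M) (θ : CForm E M) (e : OpenPartialHomeomorph M E)
    (p u v : E) : localNabla g θ e p u v =
      fderiv ℝ (localForm θ e) p u v - localForm θ e p (christoffel g e p u v) := rfl

/-- The covariant derivative `u ↦ ∇_u θ` of a complex 1-form at `x` (Levi-Civita connection of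
`g`), computed in the chart `e`. -/
def nablaForm (g : Metric E M) (θ : CForm E M) (e : OpenPartialHomeomorph M E) (x : M) :
    Tan E x →ₗ[ℝ] (Tan E x →L[ℝ] ℂ) where
  toFun u := (localNabla g θ e (e x) (toCoord e x u)).comp (toCoord e x)
  map_add' u v := by ext; simp
  map_smul' a u := by ext; simp

theorem nablaForm_apply (g : Metric E M) (θ : CForm E M) (e : OpenPartialHomeomorph M E) (x : M)
    (u v : Tan E x) : nablaForm g θ e x u v =
      localNabla g θ e (e x) (toCoord e x u) (toCoord e x v) := rfl

/-! ### f-structures -/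

/-- Smoothness of a section of `End(TM)`. -/
def SmoothEnd (F : EndField E M) : Prop :=
  ContMDiff 𝓘(ℝ, E) (𝓘(ℝ, E).prod 𝓘(ℝ, E →L[ℝ] E)) ∞
    (fun x : M => TotalSpace.mk' (E →L[ℝ] E)
      (E := fun x : M => Tan E x →L[ℝ] Tan E x) x (F x))

/-- Smoothness on `U` of a complex 1-form. -/
def SmoothCFormOn (θ : CForm E M) (U : Set M) : Prop :=
  ContMDiffOn 𝓘(ℝ, E) (𝓘(ℝ, E).prod 𝓘(ℝ, E →L[ℝ] ℂ)) ∞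
    (fun x : M => TotalSpace.mk' (E →L[ℝ] ℂ)
      (E := fun x : M => Tan E x →L[ℝ] Bundle.Trivial M ℂ x) x (θ x)) U

/-- An f-structure on `(M, g)`: a smooth skew-symmetric section `F` of `End(TM)` with
`F³ + F = 0`. -/
structure IsFStructure (g : Metric E M) (F : EndField E M) : Prop where
  smooth : SmoothEnd F
  skew : ∀ (x : M) (v w : Tan E x), g.inner x (F x v) w = - g.inner x v (F x w)
  cube : ∀ (x : M) (v : Tan E x), F x (F x (F x v)) + F x v = 0

/-- The constant endomorphism `(a, b, c) ↦ (-b, a, 0)` of `ℝᵐ × ℝᵐ × ℝᵏ`. -/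
def stdF (m k : ℕ) (v : (Fin m → ℝ) × (Fin m → ℝ) × (Fin k → ℝ)) :
    (Fin m → ℝ) × (Fin m → ℝ) × (Fin k → ℝ) :=
  (-v.2.1, v.1, 0)

/-- Integrability: around each point there are local coordinates (a smooth chart followed by a
linear identification of the model space with `ℝᵐ × ℝᵐ × ℝᵏ`) in which the section `F` of
`End(TM)` has the constant components `(a, b, c) ↦ (-b, a, 0)`. -/
def IsIntegrable (F : EndField E M) : Prop :=
  ∀ x : M, ∃ e ∈ Charts E M, x ∈ e.source ∧
    ∃ (m k : ℕ) (L : E ≃L[ℝ] (Fin m → ℝ) × (Fin m → ℝ) × (Fin k → ℝ)),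
      ∀ y ∈ e.source, ∀ v : Tan E y,
        L (toCoord e y (F y v)) = stdF m k (L (toCoord e y v))

/-- The fundamental 2-form `ω(X, Y) = g(X, F Y)`. -/
def fundamentalForm (g : Metric E M) (F : EndField E M) : BilinField E M := fun x =>
  (ContinuousLinearMap.bilinearComp (E := E) (F := E) (E' := E) (F' := E)
    (g.inner x) (.id ℝ E) (F x) : E →L[ℝ] E →L[ℝ] ℝ)

theorem fundamentalForm_apply (g : Metric E M) (F : EndField E M) (x : M) (v w : Tan E x) :
    fundamentalForm g F x v w = g.inner x v (F x w) := rfl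

/-- The complex tangent vectors at `x` of type `s`: an eigenspace of the complex-linear extension
of `F` to the complexified tangent space. -/
def tangentType (F : EndField E M) (s : FType) (x : M) : Submodule ℂ (ℂ ⊗[ℝ] Tan E x) :=
  Module.End.eigenspace ((F x).toLinearMap.baseChange ℂ) s.eigenvalue

/-- The complex covectors at `x` of type `s`: those with `θ ∘ F = i θ`, `-i θ`, `0`. -/
def cotangentType (F : EndField E M) (s : FType) (x : M) : Submodule ℂ (Tan E x →L[ℝ] ℂ) where
  carrier := {θ | ∀ v, θ (F x v) = s.eigenvalue * θ v}
  add_mem' := by intro a b ha hb v; simp [ha v, hb v, mul_add]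
  zero_mem' := by intro v; simp
  smul_mem' := by intro c a ha v; simp [ha v, mul_left_comm]

/-- The condition `∇_{T⁰M}(T*⁺M) ⊆ T*⁺M + T*⁻M`: for every smooth local section `θ` of `T*⁺M` and
every complex tangent vector `X` of type `0`, `∇_X θ` lies in `T*⁺M + T*⁻M`. -/
def CondMet (g : Metric E M) (F : EndField E M) : Prop :=
  ∀ (U : Set M) (θ : CForm E M), IsOpen U → SmoothCFormOn θ U →
    (∀ y ∈ U, θ y ∈ cotangentType F .plus y) →
    ∀ x ∈ U, ∀ e ∈ Charts E M, x ∈ e.source → ∀ X ∈ tangentType F .zero x,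
      cLift _ (nablaForm g θ e x) X ∈ cotangentType F .plus x ⊔ cotangentType F .minus x

/-- The condition `dω^{(1,2)} = 0` on the fundamental 2-form: `dω(u, v, w) = 0` whenever `u, v` are
complex tangent vectors of the same type and `w` is of a different type. -/
def CondSym (g : Metric E M) (F : EndField E M) : Prop :=
  ∀ (x : M), ∀ e ∈ Charts E M, x ∈ e.source → ∀ s t : FType, s ≠ t →
    ∀ u ∈ tangentType F s x, ∀ v ∈ tangentType F s x, ∀ w ∈ tangentType F t x,
      cTrilinear (extDerivAt (fundamentalForm g F) e x) u v w = 0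

/-- `(M, J, g)` is a Kähler manifold: `J` is an integrable almost complex structure (so `M` is a
complex manifold), `g` is Hermitian, and the fundamental 2-form is closed. -/
structure IsKahler (g : Metric E M) (J : EndField E M) : Prop where
  smooth : SmoothEnd J
  sq : ∀ (x : M) (v : Tan E x), J x (J x v) = -v
  hermitian : ∀ (x : M) (v w : Tan E x), g.inner x (J x v) (J x w) = g.inner x v w
  integrable : IsIntegrable J
  closed : ∀ (x : M), ∀ e ∈ Charts E M, x ∈ e.source → extDerivAt (fundamentalForm g J) e x = 0

end Geometry

/-! ### Maps -/

section Maps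

variable {E : Type*} [NormedAddCommGroup E] [NormedSpace ℝ E]
variable {M : Type*} [TopologicalSpace M] [ChartedSpace E M]
variable {E' : Type*} [NormedAddCommGroup E'] [NormedSpace ℝ E']
variable {N : Type*} [TopologicalSpace N] [ChartedSpace E' N]

/-- A map is f-holomorphic if its differential intertwines the two endomorphism fields. -/
def IsFHolomorphic (F : EndField E M) (J : EndField E' N) (φ : M → N) : Prop :=
  ∀ (x : M) (v : Tan E x),
    mfderiv 𝓘(ℝ, E) 𝓘(ℝ, E') φ x (F x v) = J (φ x) (mfderiv 𝓘(ℝ, E) 𝓘(ℝ, E') φ x v)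

variable [IsManifold 𝓘(ℝ, E) ∞ M] [IsManifold 𝓘(ℝ, E') ∞ N]

/-- The second fundamental form `∇dφ(u, v)` of `φ` in the charts `e` of `M` and `e'` of `N`:
`∂_u ∂_v φ - dφ(Γᴹ(u, v)) + Γᴺ(dφ u, dφ v)`. -/
def localSecondFF (g : Metric E M) (h : Metric E' N) (φ : M → N)
    (e : OpenPartialHomeomorph M E) (e' : OpenPartialHomeomorph N E') (p u v : E) : E' :=
  let f : E → E' := fun q => e' (φ (e.symm q))
  fderiv ℝ (fderiv ℝ f) p u v - fderiv ℝ f p (christoffel g e p u v)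
    + christoffel h e' (f p) (fderiv ℝ f p u) (fderiv ℝ f p v)

/-- The tension field of `φ`, that is the trace `∑ gⁱʲ ∇dφ(∂ᵢ, ∂ⱼ)` of its second fundamental form,
in the charts `e` and `e'`. Here `∑ⱼ gⁱʲ ∂ⱼ` is obtained by raising the index of `dxⁱ`. -/
def localTension [FiniteDimensional ℝ E] (g : Metric E M) (h : Metric E' N) (φ : M → N)
    (e : OpenPartialHomeomorph M E) (e' : OpenPartialHomeomorph N E') (p : E) : E' :=
  let b := Module.finBasis ℝ E
  ∑ i, localSecondFF g h φ e e' p (b i) (sharp g e p (LinearMap.toContinuousLinearMap (b.coord i)))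

/-- A map is harmonic if its tension field vanishes at every point (in all charts). -/
def IsHarmonic [FiniteDimensional ℝ E] (g : Metric E M) (h : Metric E' N) (φ : M → N) : Prop :=
  ∀ (x : M), ∀ e ∈ Charts E M, x ∈ e.source → ∀ e' ∈ Charts E' N, φ x ∈ e'.source →
    localTension g h φ e e' (e x) = 0

end Maps

end FStr

end

/-! Write B = ∇dφ and D = ∇F. Since N is Kähler, ∇J = 0, so differentiating dφ∘F = J∘dφ gives B(u,
Fv) + dφ((D_u F)v) = J B(u, v) (`bilinSecondFF_localEnd`). As F is skew with F³ = -F, the tangent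
space is the orthogonal sum of ker F and im F, and the trace of B is treated on each summand.

On ker F, the condition on ∇T*⁺M forces (D_u F)v = 0 for u, v in ker F
(`nablaEnd_eq_zero_of_condMet`), so J B(u, v) = 0 and B vanishes there. On im F, put y = Fx.
Combining the formula at (Fy, y) with J applied to the formula at (y, y), the symmetry of B yields
B(y, y) + B(Fy, Fy) = -dφ(w), where w = F(D_y F)y + (D_{Fy} F)y. The condition on dω gives Fw = 0
(`map_add_eq_zero_of_closed`), so J dφ(w) = dφ(Fw) = 0 and dφ(w) = 0.

Finally F is an isometry of im F, so this anti-invariance kills the trace over im F;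
`sum_basis_sharp_eq_zero` does this without orthonormal frames. All of it is done in charts, with
covariant derivatives written through Christoffel symbols. -/

namespace FStr

/-! ### Linear algebra at a point: metric traces and the tensors ∇J, ∇F -/

section PointwiseAlgebra

variable {E : Type*} [NormedAddCommGroup E] [NormedSpace ℝ E]

/-- Moving an endomorphism across a metric trace replaces it by its adjoint. -/
theorem sum_apply_sharp_adjoint {W ι : Type*} [AddCommGroup W] [Module ℝ W]
    [FiniteDimensional ℝ E] [Fintype ι]
    (b : Module.Basis ι ℝ E) (G : E →L[ℝ] E →L[ℝ] ℝ) (S : (E →L[ℝ] ℝ) →L[ℝ] E)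
    (hS : ∀ α v, G (S α) v = α v) (hG : ∀ u, (∀ v, G u v = 0) → u = 0)
    (A A' : E →L[ℝ] E) (hA : ∀ u v, G (A' u) v = G u (A v)) (B : E →ₗ[ℝ] E →ₗ[ℝ] W) :
    ∑ i, B (A (b i)) (S (LinearMap.toContinuousLinearMap (b.coord i)))
      = ∑ i, B (b i) (A' (S (LinearMap.toContinuousLinearMap (b.coord i)))) := by
  -- The vectors S(bⁱ) form the metric dual frame of b; this expands A' of a dual vector in that
  -- frame, the coefficients being matrix entries of A.
  have key : ∀ j, A' (S (LinearMap.toContinuousLinearMap (b.coord j)))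
      = ∑ i, b.coord j (A (b i)) • S (LinearMap.toContinuousLinearMap (b.coord i)) := by
    intro j
    rw [← sub_eq_zero]
    refine hG _ fun v => ?_
    simp only [map_sub, map_sum, map_smul, sub_apply, sum_apply, smul_apply, hA, hS,
      LinearMap.coe_toContinuousLinearMap', smul_eq_mul]
    have hv := congrArg (fun v => b.coord j (A v)) (b.sum_repr v)
    simp only [map_sum, map_smul, smul_eq_mul] at hv
    rw [sub_eq_zero, ← hv]
    exact Finset.sum_congr rfl fun i _ => by rw [b.coord_apply i v, mul_comm]
  simp_rw [key, map_sum, map_smul]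
  rw [Finset.sum_comm]
  refine Finset.sum_congr rfl fun i _ => ?_
  have hv := congrArg (fun v => B v (S (LinearMap.toContinuousLinearMap (b.coord i))))
    (b.sum_repr (A (b i)))
  simp only [map_sum, map_smul, LinearMap.sum_apply, LinearMap.smul_apply] at hv
  exact hv.symm

/-- The metric trace of a bilinear map vanishes if the map vanishes on the kernel of `F` and is
`F`-anti-invariant on the image of `F`. -/
theorem sum_basis_sharp_eq_zero {W ι : Type*} [AddCommGroup W] [Module ℝ W]
    [FiniteDimensional ℝ E] [Fintype ι]
    (b : Module.Basis ι ℝ E) (G : E →L[ℝ] E →L[ℝ] ℝ) (S : (E →L[ℝ] ℝ) →L[ℝ] E)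
    (hS : ∀ α v, G (S α) v = α v) (hG : ∀ u, (∀ v, G u v = 0) → u = 0)
    (F : E →L[ℝ] E) (skew : ∀ u v, G (F u) v = - G u (F v))
    (cube : ∀ v, F (F (F v)) = - F v) (B : E →ₗ[ℝ] E →ₗ[ℝ] W)
    (hker : ∀ u v, F u = 0 → F v = 0 → B u v = 0)
    (him : ∀ u v, B (F u) (F v) + B (F (F u)) (F (F v)) = 0) :
    ∑ i, B (b i) (S (LinearMap.toContinuousLinearMap (b.coord i))) = 0 := by
  set s : ι → E := fun i => S (LinearMap.toContinuousLinearMap (b.coord i)) with hs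
  have h1 : ∑ i, B (F (b i)) (F (s i)) = - ∑ i, B (b i) (F (F (s i))) := by
    have := sum_apply_sharp_adjoint b G S hS hG F (-F) (fun u v => by simp [skew])
      (B.compl₂ F.toLinearMap)
    simpa [hs] using this
  have h2 : ∑ i, B (F (F (b i))) (F (F (s i))) = - ∑ i, B (b i) (F (F (s i))) := by
    have := sum_apply_sharp_adjoint b G S hS hG (F.comp F) (F.comp F) (fun u v => by simp [skew])
      (B.compl₂ (F.comp F).toLinearMap)
    simpa [hs, cube] using this
  have h3 : ∑ i, B (F (F (b i))) (s i) = ∑ i, B (b i) (F (F (s i))) := by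
    have := sum_apply_sharp_adjoint b G S hS hG (F.comp F) (F.comp F) (fun u v => by simp [skew]) B
    simpa [hs] using this
  have h4 : ∑ i, (B (F (b i)) (F (s i)) + B (F (F (b i))) (F (F (s i)))) = 0 :=
    Finset.sum_eq_zero fun i _ => him _ _
  -- The map 1 + F² is the projection onto ker F. With T = ∑ B(bᵢ, F²sᵢ), the image condition reads
  -- -2T = 0 and the kernel condition reads trace + T = 0.
  have h5 : ∑ i, B (b i + F (F (b i))) (s i + F (F (s i))) = 0 :=
    Finset.sum_eq_zero fun i _ => hker _ _ (by simp [cube]) (by simp [cube])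
  simp only [map_add, LinearMap.add_apply, Finset.sum_add_distrib] at h4 h5
  rw [h1, h2] at h4
  rw [h2, h3] at h5
  have h6 : ∑ i, B (b i) (F (F (s i))) = 0 := by
    have : (2 : ℝ) • ∑ i, B (b i) (F (F (s i))) = 0 := by
      rw [two_smul, ← neg_eq_zero, neg_add]; exact h4
    simpa using this
  rw [h6] at h5
  simpa using h5

variable (G : E →L[ℝ] E →L[ℝ] ℝ) (hsymm : ∀ u v, G u v = G v u)
  (hG : ∀ u, (∀ v, G u v = 0) → u = 0)
  (D : E →ₗ[ℝ] E →ₗ[ℝ] E) (hD : ∀ u v w, G (D u v) w = - G v (D u w))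

include hsymm hG hD in
/-- An almost Hermitian structure with vanishing Nijenhuis tensor and closed fundamental form is
parallel. Here `D` stands for `∇J`. -/
theorem eq_zero_of_nijenhuis_of_closed (J : E →L[ℝ] E)
    (skew : ∀ u v, G (J u) v = - G u (J v)) (sq : ∀ v, J (J v) = - v)
    (anti : ∀ u v, D u (J v) = - J (D u v))
    (nij : ∀ u v, D (J u) v - J (D u v) = D (J v) u - J (D v u))
    (closed : ∀ u v w, G v (D u w) + G w (D v u) + G u (D w v) = 0) (x y : E) : D x y = 0 := by
  have alt : ∀ u v w, G v (D u w) = - G w (D u v) := fun u v w => by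
    rw [hsymm v, hD]
  have hJ : ∀ u v w, G (J v) (D u w) = G v (D u (J w)) := fun u v w => by
    rw [skew, anti, map_neg]
  refine hG _ fun z => ?_
  rw [hsymm]
  -- Classical identity: dω(x, y, z) - dω(x, Jy, Jz) equals 2 g(y, (∇_x J)z) plus the pairing of Jx
  -- with the Nijenhuis expression at (y, z). Both closedness and `nij` therefore kill g(y, (∇_x
  -- J)z).
  have n := congrArg (G (J x)) (nij y z)
  have c1 := closed x y z
  have c2 := closed x (J y) (J z)
  rw [hJ x y, sq, alt (J y) (J z) x, ← hJ (J y) x z, ← hJ (J z) x y] at c2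
  rw [map_sub, map_sub, skew x (J (D y z)), skew x (J (D z y)), sq, sq] at n
  have a1 := alt x z y
  have a2 := alt y z x
  simp only [map_neg] at *
  linarith

include hsymm hG hD in
/-- Here `D` stands for `∇F`, for an f-structure `F`; the last hypothesis says that
`dω(X, FX, Z) = 0` for `X` and `Z` in the image of `F`. -/
theorem map_add_eq_zero_of_closed (F : E →L[ℝ] E)
    (skew : ∀ u v, G (F u) v = - G u (F v)) (cube : ∀ v, F (F (F v)) = - F v)
    (dcube : ∀ u v, D u (F (F v)) + F (D u (F v)) + F (F (D u v)) + D u v = 0)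
    (closed : ∀ x z, G (F (F x)) (D (F x) (F z)) + G (F z) (D (F (F x)) (F x))
      + G (F x) (D (F z) (F (F x))) = 0) (x : E) :
    F (F (D (F x) (F x)) + D (F (F x)) (F x)) = 0 := by
  have alt : ∀ u v w, G v (D u w) = - G w (D u v) := fun u v w => by
    rw [hsymm v, hD]
  -- Modulo ker F, D_u anticommutes with F on im F; this comes from applying F to the derivative of
  -- F³ = -F.
  have h1 : ∀ u v, F (D u (F v)) = F (F (D u (F (F v)))) := fun u v => by
    have := congrArg F (dcube u (F v))
    simp only [map_add, cube, map_neg, map_zero] at this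
    rw [← sub_eq_zero, ← neg_eq_zero, ← this]
    abel
  refine hG _ fun z => ?_
  have h2 := congrArg (G z) (h1 (F x) (F x))
  have h3 := closed x z
  have h4 := h1 (F z) x
  have h5 := h1 (F x) x
  have h6 := congrArg (G x) (h1 (F z) (F x))
  simp only [cube, map_neg] at *
  have h7 := alt (F z) (F x) (F (F x))
  -- With y = Fx, skewness of F and of D_u together with the anticommutation make g(y, D_u Fy) equal
  -- to its own negative. Only two terms of the cyclic sum survive, and they pair z with the
  -- asserted vector.
  have h8 : G (F x) (D (F z) (F (F x))) = 0 := by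
    have a := skew x (D (F z) (F (F x)))
    have b := skew x (F (D (F z) (F x)))
    have c := skew (F x) (D (F z) (F x))
    linarith
  have h9 := alt (F x) (F (F x)) (F z)
  have a := skew z (F (D (F x) (F x)))
  have b := skew z (D (F x) (F (F x)))
  have c := hsymm (F (F (D (F x) (F x)))) z
  have d := hsymm (F (D (F (F x)) (F x))) z
  have f := skew z (D (F (F x)) (F x))
  simp only [map_add, add_apply]
  linarith

end PointwiseAlgebra

/-! ### Smoothness of coordinate expressions -/

section ChartCalculus

variable {E : Type*} [NormedAddCommGroup E] [NormedSpace ℝ E]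
variable {M : Type*} [TopologicalSpace M] [ChartedSpace E M]

/-- The coordinate expression of an endomorphism field in the chart `e`. -/
noncomputable def localEnd (F : EndField E M) (e : OpenPartialHomeomorph M E) (p : E) : E →L[ℝ] E :=
  (toCoord e (e.symm p)).comp ((F (e.symm p)).comp (ofCoord e p))

theorem localEnd_apply (F : EndField E M) (e : OpenPartialHomeomorph M E) (p u : E) :
    localEnd F e p u = toCoord e (e.symm p) (F (e.symm p) (ofCoord e p u)) := rfl

variable [IsManifold 𝓘(ℝ, E) ∞ M]
variable {e : OpenPartialHomeomorph M E}

omit [IsManifold 𝓘(ℝ, E) ∞ M] in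
theorem mdifferentiable_of_mem_charts (he : e ∈ Charts E M) :
    e.MDifferentiable 𝓘(ℝ, E) 𝓘(ℝ, E) :=
  ⟨(contMDiffOn_of_mem_maximalAtlas he).mdifferentiableOn (by simp),
    (contMDiffOn_symm_of_mem_maximalAtlas he).mdifferentiableOn (by simp)⟩

omit [IsManifold 𝓘(ℝ, E) ∞ M] in
theorem toCoord_ofCoord (he : e ∈ Charts E M) {p : E} (hp : p ∈ e.target) (u : E) :
    toCoord e (e.symm p) (ofCoord e p u) = u :=
  DFunLike.congr_fun ((mdifferentiable_of_mem_charts he).comp_symm_deriv hp) u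

omit [IsManifold 𝓘(ℝ, E) ∞ M] in
theorem ofCoord_toCoord (he : e ∈ Charts E M) {p : E} (hp : p ∈ e.target)
    (w : Tan E (e.symm p)) : ofCoord e p (toCoord e (e.symm p) w) = w :=
  (mdifferentiable_of_mem_charts he).mfderiv_injective (e.map_target hp)
    (toCoord_ofCoord he hp _)

/-- The field is the tangent map of the inverse chart applied to the constant section u. -/
theorem contMDiffAt_ofCoord (he : e ∈ Charts E M) {p : E} (hp : p ∈ e.target) (u : E) :
    ContMDiffAt 𝓘(ℝ, E) (𝓘(ℝ, E).prod 𝓘(ℝ, E)) ∞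
      (fun q => TotalSpace.mk' E (E := fun x : M => Tan E x) (e.symm q) (ofCoord e q u)) p := by
  have h := (contMDiffOn_symm_of_mem_maximalAtlas he).contMDiffOn_tangentMapWithin (m := ∞)
    (by simp) e.open_target.uniqueMDiffOn
  have hc : ContMDiff 𝓘(ℝ, E) (𝓘(ℝ, E).prod 𝓘(ℝ, E)) ∞
      (fun q : E => (⟨q, u⟩ : TangentBundle 𝓘(ℝ, E) E)) :=
    contMDiff_vectorSpace_iff_contDiff.2 contDiff_const
  have h2 := h.comp hc.contMDiffOn (s := e.target) (fun q hq => hq)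
  refine (h2.contMDiffAt (e.open_target.mem_nhds hp)).congr_of_eventuallyEq ?_
  filter_upwards [e.open_target.mem_nhds hp] with q hq
  simp only [Function.comp, tangentMapWithin, mfderivWithin_of_isOpen e.open_target hq]
  rfl

/-- The coordinates are the fibre part of the tangent map of e. Fields along a map b are allowed so
that b can be the inverse chart or the identity. -/
theorem contMDiffAt_toCoord (he : e ∈ Charts E M) {A : Type*} [NormedAddCommGroup A]
    [NormedSpace ℝ A] {B : Type*} [TopologicalSpace B] [ChartedSpace A B] {b : B → M}
    {w : ∀ q, Tan E (b q)} {q₀ : B} (hq : b q₀ ∈ e.source)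
    (hw : ContMDiffAt 𝓘(ℝ, A) (𝓘(ℝ, E).prod 𝓘(ℝ, E)) ∞
      (fun q => TotalSpace.mk' E (E := fun x : M => Tan E x) (b q) (w q)) q₀) :
    ContMDiffAt 𝓘(ℝ, A) 𝓘(ℝ, E) ∞ (fun q => toCoord e (b q) (w q)) q₀ := by
  have h := (contMDiffOn_of_mem_maximalAtlas he).contMDiffOn_tangentMapWithin (m := ∞)
    (by simp) e.open_source.uniqueMDiffOn
  have hb : ContMDiffAt 𝓘(ℝ, A) 𝓘(ℝ, E) ∞ b q₀ := (contMDiffAt_totalSpace.1 hw).1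
  have h1 := h.contMDiffAt (x := ⟨b q₀, w q₀⟩)
    ((e.open_source.preimage (FiberBundle.continuous_proj E (TangentSpace 𝓘(ℝ, E)))).mem_nhds hq)
  have h2 := ContMDiffAt.comp q₀ h1 hw
  have h3 := (contMDiffAt_totalSpace.1 h2).2
  refine h3.congr_of_eventuallyEq ?_
  filter_upwards [hb.continuousAt.preimage_mem_nhds (e.open_source.mem_nhds hq)] with q hq
  simp only [Function.comp, tangentMapWithin, mfderivWithin_of_isOpen e.open_source hq]
  simp [toCoord]
  rfl

variable [FiniteDimensional ℝ E]

theorem contDiffAt_clm_of_apply {E₁ E₂ E₃ : Type*} [NormedAddCommGroup E₁] [NormedSpace ℝ E₁]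
    [NormedAddCommGroup E₂] [NormedSpace ℝ E₂] [FiniteDimensional ℝ E₂]
    [NormedAddCommGroup E₃] [NormedSpace ℝ E₃] {f : E₁ → E₂ →L[ℝ] E₃} {s : Set E₁}
    (hs : IsOpen s) (h : ∀ p ∈ s, ∀ u, ContDiffAt ℝ ∞ (fun q => f q u) p) {p : E₁} (hp : p ∈ s) :
    ContDiffAt ℝ ∞ f p :=
  (contDiffOn_clm_apply.2 fun u q hq => (h q hq u).contDiffWithinAt).contDiffAt (hs.mem_nhds hp)

theorem contDiffAt_localMetric (g : Metric E M) (he : e ∈ Charts E M) {p : E} (hp : p ∈ e.target) :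
    ContDiffAt ℝ ∞ (localMetric g e) p := by
  refine contDiffAt_clm_of_apply e.open_target (fun p hp u => ?_) hp
  refine contDiffAt_clm_of_apply e.open_target (fun p hp v => ?_) hp
  have hs : ContMDiffAt 𝓘(ℝ, E) 𝓘(ℝ, E) ∞ e.symm p :=
    (contMDiffOn_symm_of_mem_maximalAtlas he).contMDiffAt (e.open_target.mem_nhds hp)
  have h := ContMDiffAt.clm_bundle_apply₂ (F₁ := E) (F₂ := E) (F₃ := ℝ)
    (E₃ := Bundle.Trivial M ℝ)
    ((g.contMDiff (e.symm p)).comp p hs) (contMDiffAt_ofCoord he hp u)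
    (contMDiffAt_ofCoord he hp v)
  exact contMDiffAt_iff_contDiffAt.1 (contMDiffAt_totalSpace.1 h).2

theorem contDiffAt_localEnd {F : EndField E M} (hF : SmoothEnd F) (he : e ∈ Charts E M) {p : E}
    (hp : p ∈ e.target) : ContDiffAt ℝ ∞ (localEnd F e) p := by
  refine contDiffAt_clm_of_apply e.open_target (fun p hp u => ?_) hp
  have hs : ContMDiffAt 𝓘(ℝ, E) 𝓘(ℝ, E) ∞ e.symm p :=
    (contMDiffOn_symm_of_mem_maximalAtlas he).contMDiffAt (e.open_target.mem_nhds hp)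
  exact contMDiffAt_iff_contDiffAt.1 (contMDiffAt_toCoord he (e.map_target hp)
    (ContMDiffAt.clm_bundle_apply ((hF (e.symm p)).comp p hs) (contMDiffAt_ofCoord he hp u)))

end ChartCalculus

/-! ### Levi-Civita calculus in a chart: ∇F and dω -/

section LocalGeometry

variable {E : Type*} [NormedAddCommGroup E] [NormedSpace ℝ E] [FiniteDimensional ℝ E]
variable {M : Type*} [TopologicalSpace M] [ChartedSpace E M] [IsManifold 𝓘(ℝ, E) ∞ M]
variable {e : OpenPartialHomeomorph M E} {p : E} (g : Metric E M) {F : EndField E M}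

omit [FiniteDimensional ℝ E] in
theorem localMetric_apply (g : Metric E M) (e : OpenPartialHomeomorph M E) (p u v : E) :
    localMetric g e p u v = g.inner (e.symm p) (ofCoord e p u) (ofCoord e p v) := rfl

omit [FiniteDimensional ℝ E] in
theorem localMetric_symm (p u v : E) : localMetric g e p u v = localMetric g e p v u := by
  rw [localMetric_apply, localMetric_apply, g.symm]

omit [FiniteDimensional ℝ E] in
theorem eq_zero_of_localMetric (he : e ∈ Charts E M) (hp : p ∈ e.target) (u : E)
    (h : ∀ v, localMetric g e p u v = 0) : u = 0 := by
  by_contra hu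
  have hu' : ofCoord e p u ≠ 0 := fun h0 => hu <| by
    rw [← toCoord_ofCoord he hp u, h0, map_zero]
  exact (g.pos _ _ hu').ne' (h u)

/-- `ContinuousLinearMap.inverse` is zero on non-invertible maps, so invertibility must be proved:
positivity gives injectivity, and E and its dual have equal dimension. -/
theorem localMetric_sharp (he : e ∈ Charts E M) (hp : p ∈ e.target) (α : E →L[ℝ] ℝ) (v : E) :
    localMetric g e p (sharp g e p α) v = α v := by
  have hinj : Function.Injective (localMetric g e p) := by
    refine (injective_iff_map_eq_zero _).2 fun u hu => eq_zero_of_localMetric g he hp u fun v => ?_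
    rw [hu]; rfl
  have hfin : Module.finrank ℝ E = Module.finrank ℝ (E →L[ℝ] ℝ) := by
    rw [← LinearEquiv.finrank_eq (LinearMap.toContinuousLinearMap (𝕜 := ℝ) (E := E) (F' := ℝ))]
    exact Subspace.dual_finrank_eq.symm
  have hinv : (localMetric g e p).IsInvertible :=
    ⟨((localMetric g e p).toLinearMap.linearEquivOfInjective hinj hfin).toContinuousLinearEquiv,
      by ext; rfl⟩
  exact DFunLike.congr_fun (hinv.self_apply_inverse α) v

theorem differentiableAt_localMetric (he : e ∈ Charts E M) (hp : p ∈ e.target) :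
    DifferentiableAt ℝ (localMetric g e) p :=
  (contDiffAt_localMetric g he hp).differentiableAt (by simp)

theorem differentiableAt_localEnd (hF : SmoothEnd F) (he : e ∈ Charts E M) (hp : p ∈ e.target) :
    DifferentiableAt ℝ (localEnd F e) p :=
  (contDiffAt_localEnd hF he hp).differentiableAt (by simp)

theorem fderiv_localMetric_symm (he : e ∈ Charts E M) (hp : p ∈ e.target) (u v w : E) :
    fderiv ℝ (localMetric g e) p u v w = fderiv ℝ (localMetric g e) p u w v := by
  have hd := (differentiableAt_localMetric g he hp).hasFDerivAt
  have h1 := (hd.clm_apply (hasFDerivAt_const v p)).clm_apply (hasFDerivAt_const w p)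
  have h2 := (hd.clm_apply (hasFDerivAt_const w p)).clm_apply (hasFDerivAt_const v p)
  have h3 := DFunLike.congr_fun
    ((h1.congr_of_eventuallyEq (.of_forall fun q => localMetric_symm g q w v)).unique h2) u
  simpa using h3

theorem christoffel_symm (he : e ∈ Charts E M) (hp : p ∈ e.target) (u v : E) :
    christoffel g e p u v = christoffel g e p v u := by
  rw [christoffel_apply, christoffel_apply]
  congr 1
  ext w
  rw [christoffelFirst_apply, christoffelFirst_apply, fderiv_localMetric_symm g he hp w u v]
  ring

/-- Metric compatibility of the connection; with the symmetry of the Christoffel symbols this is all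
that is used about them afterwards. -/
theorem fderiv_localMetric (he : e ∈ Charts E M) (hp : p ∈ e.target) (u v w : E) :
    fderiv ℝ (localMetric g e) p u v w = localMetric g e p (christoffel g e p u v) w
      + localMetric g e p v (christoffel g e p u w) := by
  rw [localMetric_symm g p v, christoffel_apply, christoffel_apply, localMetric_sharp g he hp,
    localMetric_sharp g he hp, christoffelFirst_apply, christoffelFirst_apply,
    fderiv_localMetric_symm g he hp u w v, fderiv_localMetric_symm g he hp w u v,
    fderiv_localMetric_symm g he hp v u w]
  ring

omit [FiniteDimensional ℝ E] [IsManifold 𝓘(ℝ, E) ∞ M] in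
theorem localEnd_toCoord (he : e ∈ Charts E M) (hp : p ∈ e.target) (w : Tan E (e.symm p)) :
    localEnd F e p (toCoord e (e.symm p) w) = toCoord e (e.symm p) (F (e.symm p) w) := by
  rw [localEnd_apply, ofCoord_toCoord he hp]

omit [FiniteDimensional ℝ E] [IsManifold 𝓘(ℝ, E) ∞ M] in
theorem ofCoord_localEnd (he : e ∈ Charts E M) (hp : p ∈ e.target) (u : E) :
    ofCoord e p (localEnd F e p u) = F (e.symm p) (ofCoord e p u) :=
  ofCoord_toCoord he hp _

omit [FiniteDimensional ℝ E] in
theorem localMetric_localEnd_left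
    (hskew : ∀ (x : M) (v w : Tan E x), g.inner x (F x v) w = - g.inner x v (F x w))
    (he : e ∈ Charts E M) (hp : p ∈ e.target) (u v : E) :
    localMetric g e p (localEnd F e p u) v = - localMetric g e p u (localEnd F e p v) := by
  rw [localMetric_apply, localMetric_apply, ofCoord_localEnd he hp, ofCoord_localEnd he hp, hskew]

omit [FiniteDimensional ℝ E] in
theorem localBilin_fundamentalForm (he : e ∈ Charts E M) (hp : p ∈ e.target) (u v : E) :
    localBilin (fundamentalForm g F) e p u v = localMetric g e p u (localEnd F e p v) := by
  rw [localMetric_apply, ofCoord_localEnd he hp, localBilin_apply, fundamentalForm_apply]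

omit [FiniteDimensional ℝ E] [IsManifold 𝓘(ℝ, E) ∞ M] in
theorem localEnd_cube (hcube : ∀ (x : M) (v : Tan E x), F x (F x (F x v)) + F x v = 0)
    (he : e ∈ Charts E M) (hp : p ∈ e.target) (u : E) :
    localEnd F e p (localEnd F e p (localEnd F e p u)) = - localEnd F e p u := by
  rw [localEnd_apply F e p u, localEnd_toCoord he hp, localEnd_toCoord he hp,
    eq_neg_of_add_eq_zero_left (hcube _ _), map_neg]

omit [FiniteDimensional ℝ E] [IsManifold 𝓘(ℝ, E) ∞ M] in
theorem localEnd_sq (hsq : ∀ (x : M) (v : Tan E x), F x (F x v) = - v)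
    (he : e ∈ Charts E M) (hp : p ∈ e.target) (u : E) :
    localEnd F e p (localEnd F e p u) = - u := by
  rw [localEnd_apply F e p u, localEnd_toCoord he hp, hsq, map_neg, toCoord_ofCoord he hp]

/-- The coordinate expression of the covariant derivative `(u, v) ↦ (∇_u F) v` of an endomorphism
field. -/
noncomputable def nablaEnd (F : EndField E M) (e : OpenPartialHomeomorph M E) (p : E) :
    E →ₗ[ℝ] E →ₗ[ℝ] E :=
  LinearMap.mk₂ ℝ (fun u v => fderiv ℝ (localEnd F e) p u v
      + christoffel g e p u (localEnd F e p v) - localEnd F e p (christoffel g e p u v))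
    (by intros; simp; abel) (by intros; simp [smul_sub]) (by intros; simp; abel)
    (by intros; simp [smul_sub])

omit [FiniteDimensional ℝ E] in
theorem nablaEnd_apply (u v : E) : nablaEnd g F e p u v = fderiv ℝ (localEnd F e) p u v
      + christoffel g e p u (localEnd F e p v) - localEnd F e p (christoffel g e p u v) := rfl

/-- Differentiate g(Fv, w) = -g(v, Fw); by metric compatibility the Christoffel terms assemble into
∇F on both sides. -/
theorem localMetric_nablaEnd (hF : SmoothEnd F)
    (hskew : ∀ (x : M) (v w : Tan E x), g.inner x (F x v) w = - g.inner x v (F x w))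
    (he : e ∈ Charts E M) (hp : p ∈ e.target) (u v w : E) :
    localMetric g e p (nablaEnd g F e p u v) w
      = - localMetric g e p v (nablaEnd g F e p u w) := by
  have hG := (differentiableAt_localMetric g he hp).hasFDerivAt
  have hE := (differentiableAt_localEnd hF he hp).hasFDerivAt
  have h1 := (hG.clm_apply (hE.clm_apply (hasFDerivAt_const v p))).clm_apply
    (hasFDerivAt_const w p)
  have h2 := ((hG.clm_apply (hasFDerivAt_const v p)).clm_apply
    (hE.clm_apply (hasFDerivAt_const w p))).neg
  -- Pointwise identities of F hold only on the chart target, which is open, so they may be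
  -- differentiated at p.
  have h3 : ∀ᶠ q in nhds p, -(localMetric g e q v (localEnd F e q w))
      = localMetric g e q (localEnd F e q v) w := by
    filter_upwards [e.open_target.mem_nhds hp] with q hq
    rw [localMetric_localEnd_left g hskew he hq]
  have h4 := DFunLike.congr_fun ((h1.congr_of_eventuallyEq h3).unique h2) u
  simp only [add_apply, neg_apply,
    ContinuousLinearMap.comp_apply, ContinuousLinearMap.flip_apply,
    zero_apply, map_zero, zero_add,
    fderiv_localMetric g he hp] at h4
  have h5 := localMetric_localEnd_left g hskew he hp (christoffel g e p u v) w
  have h6 := localMetric_localEnd_left g hskew he hp v (christoffel g e p u w)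
  simp only [nablaEnd_apply, map_add, map_sub, add_apply,
    sub_apply]
  linarith

/-- Leibniz rule applied to F³ + F = 0: the Christoffel corrections telescope. -/
theorem nablaEnd_cube (hF : SmoothEnd F)
    (hcube : ∀ (x : M) (v : Tan E x), F x (F x (F x v)) + F x v = 0)
    (he : e ∈ Charts E M) (hp : p ∈ e.target) (u v : E) :
    nablaEnd g F e p u (localEnd F e p (localEnd F e p v))
      + localEnd F e p (nablaEnd g F e p u (localEnd F e p v))
      + localEnd F e p (localEnd F e p (nablaEnd g F e p u v)) + nablaEnd g F e p u v = 0 := by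
  have hE := (differentiableAt_localEnd hF he hp).hasFDerivAt
  have h0 := hE.clm_apply (hasFDerivAt_const v p)
  have h1 := hE.clm_apply (hE.clm_apply h0)
  have h3 : ∀ᶠ q in nhds p, -localEnd F e q v
      = localEnd F e q (localEnd F e q (localEnd F e q v)) := by
    filter_upwards [e.open_target.mem_nhds hp] with q hq
    rw [localEnd_cube hcube he hq]
  have h4 := DFunLike.congr_fun ((h1.congr_of_eventuallyEq h3).unique h0.neg) u
  simp only [add_apply, neg_apply,
    ContinuousLinearMap.comp_apply, ContinuousLinearMap.flip_apply,
    zero_apply, map_zero, zero_add, map_add] at h4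
  simp only [nablaEnd_apply, map_add, map_sub, localEnd_cube hcube he hp, map_neg]
  rw [← sub_eq_zero] at h4
  rw [← h4]
  abel

theorem nablaEnd_anticomm (hF : SmoothEnd F)
    (hsq : ∀ (x : M) (v : Tan E x), F x (F x v) = - v)
    (he : e ∈ Charts E M) (hp : p ∈ e.target) (u v : E) :
    nablaEnd g F e p u (localEnd F e p v) = - localEnd F e p (nablaEnd g F e p u v) := by
  have hE := (differentiableAt_localEnd hF he hp).hasFDerivAt
  have h1 := hE.clm_apply (hE.clm_apply (hasFDerivAt_const v p))
  have h3 : ∀ᶠ q in nhds p, -v = localEnd F e q (localEnd F e q v) := by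
    filter_upwards [e.open_target.mem_nhds hp] with q hq
    rw [localEnd_sq hsq he hq]
  have h4 := DFunLike.congr_fun
    ((h1.congr_of_eventuallyEq h3).unique (hasFDerivAt_const (-v) p)) u
  simp only [add_apply, ContinuousLinearMap.comp_apply,
    ContinuousLinearMap.flip_apply, zero_apply, map_zero,
    zero_add] at h4
  simp only [nablaEnd_apply, map_add, map_sub, localEnd_sq hsq he hp, map_neg]
  rw [← sub_eq_zero, ← h4]
  abel

/-- The exterior derivative of the fundamental form is the cyclic sum of its covariant
derivative. -/
theorem localExtDeriv_fundamentalForm (hF : SmoothEnd F)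
    (hskew : ∀ (x : M) (v w : Tan E x), g.inner x (F x v) w = - g.inner x v (F x w))
    (he : e ∈ Charts E M) (hp : p ∈ e.target) (u v w : E) :
    localExtDeriv (fundamentalForm g F) e p u v w
      = localMetric g e p v (nablaEnd g F e p u w) + localMetric g e p w (nablaEnd g F e p v u)
        + localMetric g e p u (nablaEnd g F e p w v) := by
  have hG := (differentiableAt_localMetric g he hp).hasFDerivAt
  have hE := (differentiableAt_localEnd hF he hp).hasFDerivAt
  have hd : DifferentiableAt ℝ (localBilin (fundamentalForm g F) e) p := by
    refine (contDiffAt_clm_of_apply e.open_target (fun p hp u => ?_) hp).differentiableAt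
      (n := ∞) (by simp)
    refine contDiffAt_clm_of_apply e.open_target (fun p hp v => ?_) hp
    refine ContDiffAt.congr_of_eventuallyEq (((contDiffAt_localMetric g he hp).clm_apply
      (contDiffAt_const (c := u))).clm_apply
      ((contDiffAt_localEnd hF he hp).clm_apply (contDiffAt_const (c := v)))) ?_
    filter_upwards [e.open_target.mem_nhds hp] with q hq
    exact localBilin_fundamentalForm g he hq u v
  -- Leibniz rule for ω: two Christoffel terms plus g(v, (∇_u F)w). The former cancel in the
  -- alternating sum because Γ is symmetric.
  have key : ∀ u v w, fderiv ℝ (localBilin (fundamentalForm g F) e) p u v w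
      = localMetric g e p (christoffel g e p u v) (localEnd F e p w)
        + localMetric g e p v (localEnd F e p (christoffel g e p u w))
        + localMetric g e p v (nablaEnd g F e p u w) := by
    intro u v w
    have h1 := (hG.clm_apply (hasFDerivAt_const v p)).clm_apply
      (hE.clm_apply (hasFDerivAt_const w p))
    have h2 := (hd.hasFDerivAt.clm_apply (hasFDerivAt_const v p)).clm_apply
      (hasFDerivAt_const w p)
    have h3 : ∀ᶠ q in nhds p, localBilin (fundamentalForm g F) e q v w
        = localMetric g e q v (localEnd F e q w) := by
      filter_upwards [e.open_target.mem_nhds hp] with q hq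
      exact localBilin_fundamentalForm g he hq v w
    have h4 := DFunLike.congr_fun (h2.unique (h1.congr_of_eventuallyEq h3)) u
    simp only [add_apply,
      ContinuousLinearMap.comp_apply, ContinuousLinearMap.flip_apply,
      zero_apply, map_zero, zero_add,
      fderiv_localMetric g he hp] at h4
    rw [h4]
    simp only [nablaEnd_apply, map_add, map_sub]
    ring
  rw [localExtDeriv_apply, key, key, key, christoffel_symm g he hp v u,
    christoffel_symm g he hp w u, christoffel_symm g he hp w v]
  have h1 := localMetric_localEnd_left g hskew he hp (christoffel g e p u w) v
  have h2 := localMetric_symm g (e := e) p (localEnd F e p (christoffel g e p u w)) v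
  have h3 := localMetric_nablaEnd g hF hskew he hp v w u
  have h4 := localMetric_symm g (e := e) p (nablaEnd g F e p v w) u
  have h5 := localMetric_symm g (e := e) p (nablaEnd g F e p v u) w
  linarith

end LocalGeometry

/-! ### Tensorial consequences of the conditions on ∇T*⁺M and on dω -/

section Conditions

variable {E : Type*} [NormedAddCommGroup E] [NormedSpace ℝ E] [FiniteDimensional ℝ E]
variable {M : Type*} [TopologicalSpace M] [ChartedSpace E M] [IsManifold 𝓘(ℝ, E) ∞ M]
variable {e : OpenPartialHomeomorph M E} {p : E} (g : Metric E M) {F : EndField E M}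

/-- A basis of E₂ identifies Hom(E₂, E₃) with finitely many copies of E₃, where smoothness is
checked componentwise. -/
theorem contMDiffAt_clm_of_apply {A B E₂ E₃ : Type*} [NormedAddCommGroup A] [NormedSpace ℝ A]
    [TopologicalSpace B] [ChartedSpace A B]
    [NormedAddCommGroup E₂] [NormedSpace ℝ E₂] [FiniteDimensional ℝ E₂]
    [NormedAddCommGroup E₃] [NormedSpace ℝ E₃] {f : B → E₂ →L[ℝ] E₃} {q : B}
    (h : ∀ u, ContMDiffAt 𝓘(ℝ, A) 𝓘(ℝ, E₃) ∞ (fun y => f y u) q) :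
    ContMDiffAt 𝓘(ℝ, A) 𝓘(ℝ, E₂ →L[ℝ] E₃) ∞ f q := by
  let d := Module.finrank ℝ E₂
  have hd : d = Module.finrank ℝ (Fin d → ℝ) := (Module.finrank_fin_fun ℝ).symm
  let e₁ := ContinuousLinearEquiv.ofFinrankEq hd
  let e₂ := (e₁.arrowCongr (1 : E₃ ≃L[ℝ] E₃)).trans (ContinuousLinearEquiv.piRing (Fin d))
  have h2 : ContMDiffAt 𝓘(ℝ, A) 𝓘(ℝ, Fin d → E₃) ∞ (fun y => e₂ (f y)) q :=
    contMDiffAt_pi_space.2 fun i => h _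
  have h3 := e₂.symm.contDiff.contMDiff.contMDiffAt.comp q h2
  simpa [Function.comp_def] using h3

/-- A complex 1-form is smooth if it is smooth on the fields of a local frame. -/
theorem smoothCFormOn_of_apply {θ : CForm E M} {U : Set M} (h : ∀ y ∈ U,
    ∀ w : ∀ z : M, Tan E z, ContMDiffAt 𝓘(ℝ, E) (𝓘(ℝ, E).prod 𝓘(ℝ, E)) ∞
      (fun z => TotalSpace.mk' E (E := fun x : M => Tan E x) z (w z)) y →
    ContMDiffAt 𝓘(ℝ, E) 𝓘(ℝ, ℂ) ∞ (fun z => θ z (w z)) y) :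
    SmoothCFormOn θ U := by
  intro y hy
  refine ContMDiffAt.contMDiffWithinAt ((contMDiffAt_hom_bundle _).2 ⟨contMDiffAt_id, ?_⟩)
  refine contMDiffAt_clm_of_apply fun u => ?_
  -- The test field is the local frame field with constant value u in the trivialization at y.
  have hs := Trivialization.contMDiffAt_symmL (IB := 𝓘(ℝ, E)) (n := ∞)
    (trivializationAt E (TangentSpace 𝓘(ℝ, E)) y)
    (FiberBundle.mem_baseSet_trivializationAt' (F := E) (E := TangentSpace 𝓘(ℝ, E)) y)
  have hc : ContMDiffAt 𝓘(ℝ, E) (𝓘(ℝ, E).prod 𝓘(ℝ, E)) ∞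
      (fun z => TotalSpace.mk' E (E := Bundle.Trivial M E) z u) y :=
    contMDiffAt_totalSpace.2 ⟨contMDiffAt_id, contMDiffAt_const⟩
  refine (h y hy _ (hs.clm_bundle_apply hc)).congr_of_eventuallyEq (.of_forall fun z => ?_)
  simp [ContinuousLinearMap.inCoordinates]

/-- The 1-form `α ∘ (F² + iF)` of type `+` attached to a covector `α` in the chart `e`. -/
noncomputable def plusForm (F : EndField E M) (e : OpenPartialHomeomorph M E) (α : E →L[ℝ] ℝ) :
    CForm E M := fun y =>
  ((Complex.ofRealCLM.comp α).comp (toCoord e y)).comp ((F y).comp (F y))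
    + Complex.I • ((Complex.ofRealCLM.comp α).comp (toCoord e y)).comp (F y)

omit [FiniteDimensional ℝ E] [IsManifold 𝓘(ℝ, E) ∞ M] in
theorem plusForm_apply (F : EndField E M) (e : OpenPartialHomeomorph M E) (α : E →L[ℝ] ℝ) (y : M)
    (w : Tan E y) : plusForm F e α y w
      = (α (toCoord e y (F y (F y w))) : ℂ) + Complex.I * (α (toCoord e y (F y w)) : ℂ) := rfl

theorem smoothCFormOn_plusForm (hF : SmoothEnd F) (he : e ∈ Charts E M) (α : E →L[ℝ] ℝ) :
    SmoothCFormOn (plusForm F e α) e.source := by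
  refine smoothCFormOn_of_apply fun y hy w hw => ?_
  have h1 := ContMDiffAt.clm_bundle_apply (hF y) hw
  have h2 := ContMDiffAt.clm_bundle_apply (hF y) h1
  have c := (Complex.ofRealCLM.comp α).contDiff (n := ∞)
  have c' := (Complex.I • Complex.ofRealCLM.comp α).contDiff (n := ∞)
  exact (c.contMDiff.contMDiffAt.comp y (contMDiffAt_toCoord he hy h2)).add
    (c'.contMDiff.contMDiffAt.comp y (contMDiffAt_toCoord he hy h1))

omit [FiniteDimensional ℝ E] [IsManifold 𝓘(ℝ, E) ∞ M] in
theorem plusForm_mem_cotangentType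
    (hcube : ∀ (x : M) (v : Tan E x), F x (F x (F x v)) + F x v = 0)
    (α : E →L[ℝ] ℝ) (y : M) : plusForm F e α y ∈ cotangentType F .plus y := by
  intro w
  rw [plusForm_apply, plusForm_apply, eq_neg_of_add_eq_zero_left (hcube _ _)]
  simp only [FType.eigenvalue, map_neg, Complex.ofReal_neg]
  linear_combination -(α (toCoord e y (F y w)) : ℂ) * Complex.I_mul_I

/-- Since Fv = 0, only the Leibniz terms differentiating the rightmost F survive. The imaginary part
isolates α((∇_u F)v). -/
theorem localNabla_plusForm (hF : SmoothEnd F) (he : e ∈ Charts E M) (hp : p ∈ e.target)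
    (α : E →L[ℝ] ℝ) (u v : E) (hv : localEnd F e p v = 0) :
    localNabla g (plusForm F e α) e p u v = (α (localEnd F e p (nablaEnd g F e p u v)) : ℂ)
      + Complex.I * (α (nablaEnd g F e p u v) : ℂ) := by
  have hE := (differentiableAt_localEnd hF he hp).hasFDerivAt
  have hform : ∀ q ∈ e.target, ∀ v, localForm (plusForm F e α) e q v
      = (Complex.ofRealCLM.comp α) (localEnd F e q (localEnd F e q v))
        + (Complex.I • Complex.ofRealCLM.comp α) (localEnd F e q v) := by
    intro q hq v
    rw [localEnd_apply F e q v, localEnd_toCoord he hq]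
    exact plusForm_apply F e α _ _
  have hd : DifferentiableAt ℝ (localForm (plusForm F e α) e) p := by
    refine (contDiffAt_clm_of_apply e.open_target (fun p hp v => ?_) hp).differentiableAt
      (n := ∞) (by simp)
    have hE := contDiffAt_localEnd hF he hp
    have h0 := hE.clm_apply (contDiffAt_const (c := v))
    refine ContDiffAt.congr_of_eventuallyEq
      (((Complex.ofRealCLM.comp α).contDiff.contDiffAt.comp p (hE.clm_apply h0)).add
        ((Complex.I • Complex.ofRealCLM.comp α).contDiff.contDiffAt.comp p h0)) ?_
    filter_upwards [e.open_target.mem_nhds hp] with q hq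
    exact hform q hq v
  have h0 := hE.clm_apply (hasFDerivAt_const v p)
  have h1 := ((Complex.ofRealCLM.comp α).hasFDerivAt.comp p (hE.clm_apply h0)).add
    ((Complex.I • Complex.ofRealCLM.comp α).hasFDerivAt.comp p h0)
  have h2 := hd.hasFDerivAt.clm_apply (hasFDerivAt_const v p)
  have h3 := DFunLike.congr_fun (h2.unique (h1.congr_of_eventuallyEq (by
    filter_upwards [e.open_target.mem_nhds hp] with q hq
    exact hform q hq v))) u
  simp only [add_apply, ContinuousLinearMap.comp_apply, ContinuousLinearMap.flip_apply,
    zero_apply, map_zero, zero_add, hv, add_zero, smul_apply, Complex.ofRealCLM_apply,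
    smul_eq_mul] at h3
  rw [localNabla_apply, h3, hform p hp, nablaEnd_apply, hv]
  simp only [map_zero, add_zero, map_sub, ContinuousLinearMap.comp_apply, smul_apply,
    Complex.ofRealCLM_apply, smul_eq_mul, Complex.ofReal_sub]
  ring

omit [FiniteDimensional ℝ E] [IsManifold 𝓘(ℝ, E) ∞ M] in
-- For θ of type ±, ±iθ(v) = θ(Fv) = 0 on ker F; this turns the condition on ∇θ into a vanishing
-- statement.
theorem apply_eq_zero_of_mem_sup {x : M} {ψ : Tan E x →L[ℝ] ℂ}
    (hψ : ψ ∈ cotangentType F .plus x ⊔ cotangentType F .minus x) {v : Tan E x}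
    (hv : F x v = 0) : ψ v = 0 := by
  obtain ⟨a, ha, b, hb, rfl⟩ := Submodule.mem_sup.1 hψ
  have h1 := ha v
  have h2 := hb v
  rw [hv, map_zero] at h1 h2
  have h3 : a v = 0 := by simpa [FType.eigenvalue] using h1.symm
  have h4 : b v = 0 := by simpa [FType.eigenvalue] using h2.symm
  simp [h3, h4]

/-- The condition `∇_{T⁰M}(T*⁺M) ⊆ T*⁺M + T*⁻M` makes `(∇_u F) v` vanish for `u, v` in the kernel
of `F`. -/
theorem nablaEnd_eq_zero_of_condMet (hF : IsFStructure g F) (hmet : CondMet g F)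
    (he : e ∈ Charts E M) (hp : p ∈ e.target) {u v : E}
    (hu : localEnd F e p u = 0) (hv : localEnd F e p v = 0) : nablaEnd g F e p u v = 0 := by
  have hX : (1 : ℂ) ⊗ₜ[ℝ] ofCoord e p u ∈ tangentType F .zero (e.symm p) := by
    rw [tangentType, Module.End.mem_eigenspace_iff, LinearMap.baseChange_tmul]
    have h : F (e.symm p) (ofCoord e p u) = 0 := by rw [← ofCoord_localEnd he hp, hu, map_zero]
    simp [FType.eigenvalue, h]
  refine eq_zero_of_localMetric g he hp _ fun z => ?_
  rw [localMetric_symm]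
  -- Taking α = g(z, ·) for arbitrary z recovers the whole vector (∇_u F)v by nondegeneracy.
  set α := localMetric g e p z
  have h1 := hmet e.source (plusForm F e α) e.open_source (smoothCFormOn_plusForm hF.smooth he α)
    (fun y _ => plusForm_mem_cotangentType hF.cube α y) (e.symm p) (e.map_target hp) e he
    (e.map_target hp) _ hX
  have h2 : F (e.symm p) (ofCoord e p v) = 0 := by rw [← ofCoord_localEnd he hp, hv, map_zero]
  have h3 := apply_eq_zero_of_mem_sup h1 h2
  have h4 : nablaForm g (plusForm F e α) e (e.symm p) (ofCoord e p u) (ofCoord e p v) = 0 := by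
    simpa [cLift] using h3
  rw [nablaForm_apply, toCoord_ofCoord he hp, toCoord_ofCoord he hp, e.right_inv hp,
    localNabla_plusForm g hF.smooth he hp α u v hv] at h4
  simpa using congrArg Complex.im h4

theorem localExtDeriv_fundamentalForm_swap (hF : SmoothEnd F)
    (hskew : ∀ (x : M) (v w : Tan E x), g.inner x (F x v) w = - g.inner x v (F x w))
    (he : e ∈ Charts E M) (hp : p ∈ e.target) (u v w : E) :
    localExtDeriv (fundamentalForm g F) e p u v w
      = - localExtDeriv (fundamentalForm g F) e p w v u := by
  have alt : ∀ a b c, localMetric g e p b (nablaEnd g F e p a c)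
      = - localMetric g e p c (nablaEnd g F e p a b) := fun a b c => by
    rw [localMetric_symm g p b, localMetric_nablaEnd g hF hskew he hp]
  rw [localExtDeriv_fundamentalForm g hF hskew he hp,
    localExtDeriv_fundamentalForm g hF hskew he hp, alt u v w, alt v w u, alt w u v]
  ring

/-- The condition `dω^{(1,2)} = 0` implies `dω(FX, Z, X) = 0` for `X, Z` in the image of `F`. -/
theorem localExtDeriv_eq_zero_of_condSym (hF : IsFStructure g F) (hsym : CondSym g F)
    (he : e ∈ Charts E M) (hp : p ∈ e.target) (x z : E) :
    localExtDeriv (fundamentalForm g F) e p (localEnd F e p (localEnd F e p x))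
      (localEnd F e p z) (localEnd F e p x) = 0 := by
  have hc : ∀ v, F (e.symm p) (F (e.symm p) (F (e.symm p) v)) = - F (e.symm p) v :=
    fun v => eq_neg_of_add_eq_zero_left (hF.cube _ v)
  have hm : ∀ v, (1 : ℂ) ⊗ₜ[ℝ] F (e.symm p) v
      + Complex.I ⊗ₜ[ℝ] F (e.symm p) (F (e.symm p) v) ∈ tangentType F .minus (e.symm p) := by
    intro v
    rw [tangentType, Module.End.mem_eigenspace_iff]
    simp [FType.eigenvalue, LinearMap.baseChange_tmul, hc, TensorProduct.smul_tmul',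
      TensorProduct.tmul_neg, TensorProduct.neg_tmul, add_comm]
  have hpl : ∀ v, (1 : ℂ) ⊗ₜ[ℝ] F (e.symm p) v
      + (-Complex.I) ⊗ₜ[ℝ] F (e.symm p) (F (e.symm p) v) ∈ tangentType F .plus (e.symm p) := by
    intro v
    rw [tangentType, Module.End.mem_eigenspace_iff]
    simp [FType.eigenvalue, LinearMap.baseChange_tmul, hc, TensorProduct.smul_tmul',
      TensorProduct.tmul_neg, TensorProduct.neg_tmul, add_comm]
  -- With y = Fx and w = Fz, the condition is tested on y + iFy and w + iFw of type - and y - iFy of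
  -- type +.
  have h := hsym (e.symm p) e he (e.map_target hp) .minus .plus (by simp)
    _ (hm (ofCoord e p x)) _ (hm (ofCoord e p z)) _ (hpl (ofCoord e p x))
  simp only [map_add, LinearMap.add_apply, cTrilinear_tmul, extDerivAt_apply,
    ← ofCoord_localEnd he hp, toCoord_ofCoord he hp, e.right_inv hp] at h
  -- The imaginary part is dω(Fy, w, y) - dω(y, w, Fy) plus terms with equal outer arguments. The
  -- latter vanish by antisymmetry, leaving 2dω(Fy, w, y).
  have him := congrArg Complex.im h
  simp at him
  have hs := localExtDeriv_fundamentalForm_swap g hF.smooth hF.skew he hp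
  have h1 := hs (localEnd F e p x) (localEnd F e p (localEnd F e p z)) (localEnd F e p x)
  have h2 := hs (localEnd F e p x) (localEnd F e p z) (localEnd F e p (localEnd F e p x))
  have h3 := hs (localEnd F e p (localEnd F e p x)) (localEnd F e p (localEnd F e p z))
    (localEnd F e p (localEnd F e p x))
  linarith

end Conditions

/-! ### f-holomorphic maps in charts -/

section HolomorphicMaps

variable {E : Type*} [NormedAddCommGroup E] [NormedSpace ℝ E]
variable {M : Type*} [TopologicalSpace M] [ChartedSpace E M]
variable {E' : Type*} [NormedAddCommGroup E'] [NormedSpace ℝ E']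
variable {N : Type*} [TopologicalSpace N] [ChartedSpace E' N]
variable {F : EndField E M} {J : EndField E' N} {φ : M → N}
variable {e : OpenPartialHomeomorph M E} {e' : OpenPartialHomeomorph N E'} {p : E}

/-- The coordinate expression of a map between manifolds. -/
def localMap (φ : M → N) (e : OpenPartialHomeomorph M E) (e' : OpenPartialHomeomorph N E') :
    E → E' := fun q => e' (φ (e.symm q))

theorem localEnd_toCoord_of_mem_source (he : e ∈ Charts E M) {y : M} (hy : y ∈ e.source)
    (w : Tan E y) : localEnd F e (e y) (toCoord e y w) = toCoord e y (F y w) := by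
  obtain ⟨p, hp, rfl⟩ : ∃ p ∈ e.target, e.symm p = y := ⟨e y, e.map_source hy, e.left_inv hy⟩
  rw [e.right_inv hp, localEnd_toCoord he hp]

theorem fderiv_localMap (he : e ∈ Charts E M) (he' : e' ∈ Charts E' N)
    (hφ : ContMDiff 𝓘(ℝ, E) 𝓘(ℝ, E') ∞ φ) (hp : p ∈ e.target) (hp' : φ (e.symm p) ∈ e'.source)
    (v : E) : fderiv ℝ (localMap φ e e') p v
      = toCoord e' (φ (e.symm p)) (mfderiv 𝓘(ℝ, E) 𝓘(ℝ, E') φ (e.symm p) (ofCoord e p v)) := by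
  have h1 := ((mdifferentiable_of_mem_charts he).mdifferentiableAt_symm hp).hasMFDerivAt
  have h2 := ((hφ (e.symm p)).mdifferentiableAt (by simp)).hasMFDerivAt
  have h3 := ((mdifferentiable_of_mem_charts he').mdifferentiableAt hp').hasMFDerivAt
  have h := (h3.comp p (h2.comp p h1)).mfderiv
  rw [← mfderiv_eq_fderiv]
  exact DFunLike.congr_fun h v

/-- The intertwining equation in coordinates, valid near p and hence ready to be differentiated. It
also serves for the identity map, read in two charts. -/
theorem localEnd_fderiv_localMap (he : e ∈ Charts E M) (he' : e' ∈ Charts E' N)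
    (hφ : ContMDiff 𝓘(ℝ, E) 𝓘(ℝ, E') ∞ φ) (hhol : IsFHolomorphic F J φ) (hp : p ∈ e.target)
    (hp' : φ (e.symm p) ∈ e'.source) (v : E) :
    localEnd J e' (localMap φ e e' p) (fderiv ℝ (localMap φ e e') p v)
      = fderiv ℝ (localMap φ e e') p (localEnd F e p v) := by
  rw [fderiv_localMap he he' hφ hp hp', fderiv_localMap he he' hφ hp hp', ofCoord_localEnd he hp,
    hhol]
  exact localEnd_toCoord_of_mem_source he' hp' _

theorem contDiffAt_localMap (he : e ∈ Charts E M) (he' : e' ∈ Charts E' N)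
    (hφ : ContMDiff 𝓘(ℝ, E) 𝓘(ℝ, E') ∞ φ) (hp : p ∈ e.target) (hp' : φ (e.symm p) ∈ e'.source) :
    ContDiffAt ℝ ∞ (localMap φ e e') p := by
  have h1 := (contMDiffOn_symm_of_mem_maximalAtlas he).contMDiffAt (e.open_target.mem_nhds hp)
  have h3 := (contMDiffOn_of_mem_maximalAtlas he').contMDiffAt (e'.open_source.mem_nhds hp')
  exact contMDiffAt_iff_contDiffAt.1 (h3.comp p ((hφ (e.symm p)).comp p h1))

theorem eventually_mem_charts
    (hφ : ContMDiff 𝓘(ℝ, E) 𝓘(ℝ, E') ∞ φ) (hp : p ∈ e.target) (hp' : φ (e.symm p) ∈ e'.source) :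
    ∀ᶠ q in nhds p, q ∈ e.target ∧ φ (e.symm q) ∈ e'.source :=
  (e.open_target.eventually_mem hp).and
    ((hφ.continuous.continuousAt.comp (e.continuousAt_symm hp)).preimage_mem_nhds
      (e'.open_source.mem_nhds hp'))

theorem fderiv_fderiv_localMap_symm (he : e ∈ Charts E M) (he' : e' ∈ Charts E' N)
    (hφ : ContMDiff 𝓘(ℝ, E) 𝓘(ℝ, E') ∞ φ) (hp : p ∈ e.target)
    (hp' : φ (e.symm p) ∈ e'.source) (u v : E) :
    fderiv ℝ (fderiv ℝ (localMap φ e e')) p u v = fderiv ℝ (fderiv ℝ (localMap φ e e')) p v u :=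
  ((contDiffAt_localMap he he' hφ hp hp').isSymmSndFDerivAt
    (by simpa using WithTop.coe_le_coe.2 (le_top (a := (2 : ℕ∞))))).eq u v

variable [IsManifold 𝓘(ℝ, E) ∞ M] [IsManifold 𝓘(ℝ, E') ∞ N]
variable [FiniteDimensional ℝ E] [FiniteDimensional ℝ E']

/-- The derivative of the equation `dφ ∘ F = J ∘ dφ` in coordinates. -/
theorem fderiv_fderiv_localMap (hF : SmoothEnd F) (hJ : SmoothEnd J) (he : e ∈ Charts E M)
    (he' : e' ∈ Charts E' N) (hφ : ContMDiff 𝓘(ℝ, E) 𝓘(ℝ, E') ∞ φ) (hhol : IsFHolomorphic F J φ)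
    (hp : p ∈ e.target) (hp' : φ (e.symm p) ∈ e'.source) (u v : E) :
    fderiv ℝ (fderiv ℝ (localMap φ e e')) p u (localEnd F e p v)
        + fderiv ℝ (localMap φ e e') p (fderiv ℝ (localEnd F e) p u v)
      = fderiv ℝ (localEnd J e') (localMap φ e e' p) (fderiv ℝ (localMap φ e e') p u)
          (fderiv ℝ (localMap φ e e') p v)
        + localEnd J e' (localMap φ e e' p) (fderiv ℝ (fderiv ℝ (localMap φ e e')) p u v) := by
  have hf := contDiffAt_localMap he he' hφ hp hp'
  have h1 := (hf.differentiableAt (by simp)).hasFDerivAt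
  have h2 := ((hf.fderiv_right (m := ∞) (by simp)).differentiableAt (by simp)).hasFDerivAt
  have hE := (differentiableAt_localEnd hF he hp).hasFDerivAt
  have hE' := (differentiableAt_localEnd hJ he' (e'.map_source hp')).hasFDerivAt
  have h3 := h2.clm_apply (hE.clm_apply (hasFDerivAt_const v p))
  have h4 := (HasFDerivAt.comp p (f := localMap φ e e') hE' h1).clm_apply
    (h2.clm_apply (hasFDerivAt_const v p))
  have h5 := DFunLike.congr_fun (h3.unique (h4.congr_of_eventuallyEq (by
    filter_upwards [eventually_mem_charts hφ hp hp'] with q hq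
    exact (localEnd_fderiv_localMap he he' hφ hhol hq.1 hq.2 v).symm))) u
  simp only [add_apply, ContinuousLinearMap.comp_apply, ContinuousLinearMap.flip_apply,
    zero_apply, map_zero, zero_add, Function.comp_apply] at h5
  rw [add_comm, h5, add_comm]
  rfl

end HolomorphicMaps

/-! ### Parallelism of the Kähler complex structure -/

section Kahler

variable {E : Type*} [NormedAddCommGroup E] [NormedSpace ℝ E] [FiniteDimensional ℝ E]
variable {M : Type*} [TopologicalSpace M] [ChartedSpace E M] [IsManifold 𝓘(ℝ, E) ∞ M]
variable {e : OpenPartialHomeomorph M E} {p : E} (g : Metric E M) {J : EndField E M}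

/-- The Nijenhuis tensor of an integrable almost complex structure vanishes. -/
theorem nijenhuis_eq_zero (hJ : SmoothEnd J) (hsq : ∀ (x : M) (v : Tan E x), J x (J x v) = - v)
    (hint : IsIntegrable J) (he : e ∈ Charts E M) (hp : p ∈ e.target) (x y : E) :
    fderiv ℝ (localEnd J e) p (localEnd J e p x) y - localEnd J e p (fderiv ℝ (localEnd J e) p x y)
      = fderiv ℝ (localEnd J e) p (localEnd J e p y) x
        - localEnd J e p (fderiv ℝ (localEnd J e) p y x) := by
  obtain ⟨e₀, he₀, hx, m, k, L, hL⟩ := hint (e.symm p)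
  obtain ⟨p₀, hp₀, h0⟩ : ∃ p₀ ∈ e₀.target, e₀.symm p₀ = e.symm p :=
    ⟨e₀ (e.symm p), e₀.map_source hx, e₀.left_inv hx⟩
  have hp' : e₀.symm p₀ ∈ e.source := h0 ▸ e.map_target hp
  obtain rfl : localMap id e₀ e p₀ = p := by
    rw [localMap, id, h0, e.right_inv hp]
  -- In the adapted chart e₀ the components of J are constant, so their derivative drops out below.
  have hconst : ∀ q ∈ e₀.target, localEnd J e₀ q = localEnd J e₀ p₀ := by
    have : ∀ q ∈ e₀.target, ∀ v, localEnd J e₀ q v = L.symm (stdF m k (L v)) := by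
      intro q hq v
      rw [localEnd_apply, ← L.symm_apply_apply (toCoord _ _ _), hL _ (e₀.map_target hq),
        toCoord_ofCoord he₀ hq]
    intro q hq
    ext v
    rw [this q hq, this p₀ hp₀]
  have hder : fderiv ℝ (localEnd J e₀) p₀ = 0 := by
    refine HasFDerivAt.fderiv ((hasFDerivAt_const (localEnd J e₀ p₀) p₀).congr_of_eventuallyEq ?_)
    filter_upwards [e₀.open_target.mem_nhds hp₀] with q hq using hconst q hq
  have hhol : IsFHolomorphic J J (id : M → M) := fun x v => by rw [mfderiv_id]; rfl
  have hid : ContMDiff 𝓘(ℝ, E) 𝓘(ℝ, E) ∞ (id : M → M) := contMDiff_id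
  have hsurj : ∀ x, ∃ u, fderiv ℝ (localMap id e₀ e) p₀ u = x := by
    intro x
    obtain ⟨w, hw⟩ := (mdifferentiable_of_mem_charts he).mfderiv_surjective hp' x
    refine ⟨toCoord e₀ (e₀.symm p₀) w, ?_⟩
    rw [fderiv_localMap he₀ he hid hp₀ hp', ofCoord_toCoord he₀ hp₀, mfderiv_id]
    exact hw
  have hR := fderiv_fderiv_localMap hJ hJ he₀ he hid hhol hp₀ hp'
  have hI := localEnd_fderiv_localMap he₀ he hid hhol hp₀ hp'
  have hS := fderiv_fderiv_localMap_symm he₀ he hid hp₀ hp'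
  -- The identity of M is holomorphic from chart e₀ to chart e; differentiating this expresses ∂J in
  -- e through second derivatives of the transition map. Their symmetry makes the Nijenhuis
  -- expression vanish.
  have key : ∀ u v, fderiv ℝ (localEnd J e) (localMap id e₀ e p₀)
        (fderiv ℝ (localMap id e₀ e) p₀ u) (fderiv ℝ (localMap id e₀ e) p₀ v)
      = fderiv ℝ (fderiv ℝ (localMap id e₀ e)) p₀ u (localEnd J e₀ p₀ v)
        - localEnd J e (localMap id e₀ e p₀) (fderiv ℝ (fderiv ℝ (localMap id e₀ e)) p₀ u v) := by
    intro u v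
    have := hR u v
    rw [hder] at this
    simp only [zero_apply, map_zero, add_zero] at this
    rw [this]
    abel
  obtain ⟨u, rfl⟩ := hsurj x
  obtain ⟨v, rfl⟩ := hsurj y
  rw [hI, hI, key, key, key, key, map_sub, map_sub, localEnd_sq hsq he hp, localEnd_sq hsq he hp,
    hS v u, hS (localEnd J e₀ p₀ v) (localEnd J e₀ p₀ u), hS (localEnd J e₀ p₀ v) u,
    hS (localEnd J e₀ p₀ u) v]
  abel

/-- The complex structure of a Kähler manifold is parallel. -/
theorem nablaEnd_eq_zero_of_isKahler (hN : IsKahler g J) (he : e ∈ Charts E M)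
    (hp : p ∈ e.target) (u v : E) : nablaEnd g J e p u v = 0 := by
  have hskew : ∀ (x : M) (v w : Tan E x), g.inner x (J x v) w = - g.inner x v (J x w) :=
    fun x v w => by rw [← hN.hermitian, hN.sq, map_neg, neg_apply]
  refine eq_zero_of_nijenhuis_of_closed (localMetric g e p) (localMetric_symm g p)
    (eq_zero_of_localMetric g he hp) (nablaEnd g J e p)
    (localMetric_nablaEnd g hN.smooth hskew he hp) (localEnd J e p)
    (localMetric_localEnd_left g hskew he hp) (localEnd_sq hN.sq he hp)
    (nablaEnd_anticomm g hN.smooth hN.sq he hp) (fun x y => ?_) (fun x y z => ?_) u v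
  -- Passing from ∂J to ∇J changes nothing: the Christoffel terms cancel by symmetry of Γ.
  · have hn := nijenhuis_eq_zero hN.smooth hN.sq hN.integrable he hp x y
    simp only [nablaEnd_apply, map_add, map_sub, localEnd_sq hN.sq he hp]
    rw [christoffel_symm g he hp (localEnd J e p y) (localEnd J e p x),
      christoffel_symm g he hp (localEnd J e p y) x, christoffel_symm g he hp y (localEnd J e p x),
      christoffel_symm g he hp y x, ← sub_eq_zero]
    rw [← sub_eq_zero] at hn
    rw [← hn]
    abel
  · rw [← localExtDeriv_fundamentalForm g hN.smooth hskew he hp]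
    have h := hN.closed (e.symm p) e he (e.map_target hp)
    have h2 := extDerivAt_apply (fundamentalForm g J) e (e.symm p) (ofCoord e p x)
      (ofCoord e p y) (ofCoord e p z)
    rw [h, toCoord_ofCoord he hp, toCoord_ofCoord he hp, toCoord_ofCoord he hp,
      e.right_inv hp] at h2
    exact h2.symm

end Kahler

/-! ### The second fundamental form and its trace -/

section Tension

variable {E : Type*} [NormedAddCommGroup E] [NormedSpace ℝ E] [FiniteDimensional ℝ E]
variable {M : Type*} [TopologicalSpace M] [ChartedSpace E M] [IsManifold 𝓘(ℝ, E) ∞ M]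
variable {E' : Type*} [NormedAddCommGroup E'] [NormedSpace ℝ E'] [FiniteDimensional ℝ E']
variable {N : Type*} [TopologicalSpace N] [ChartedSpace E' N] [IsManifold 𝓘(ℝ, E') ∞ N]
variable (g : Metric E M) {F : EndField E M} (h : Metric E' N) {J : EndField E' N} (φ : M → N)
variable (e : OpenPartialHomeomorph M E) (e' : OpenPartialHomeomorph N E') (p : E)

/-- The second fundamental form in charts, as a bilinear map. -/
noncomputable def bilinSecondFF : E →ₗ[ℝ] E →ₗ[ℝ] E' :=
  LinearMap.mk₂ ℝ (localSecondFF g h φ e e' p)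
    (by intros; simp [localSecondFF]; abel) (by intros; simp [localSecondFF, smul_sub])
    (by intros; simp [localSecondFF]; abel) (by intros; simp [localSecondFF, smul_sub])

omit [FiniteDimensional ℝ E] [FiniteDimensional ℝ E'] in
theorem bilinSecondFF_apply (u v : E) : bilinSecondFF g h φ e e' p u v
    = fderiv ℝ (fderiv ℝ (localMap φ e e')) p u v
      - fderiv ℝ (localMap φ e e') p (christoffel g e p u v)
      + christoffel h e' (localMap φ e e' p) (fderiv ℝ (localMap φ e e') p u)
        (fderiv ℝ (localMap φ e e') p v) := rfl

variable {φ e e' p}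

theorem bilinSecondFF_symm (he : e ∈ Charts E M) (he' : e' ∈ Charts E' N)
    (hφ : ContMDiff 𝓘(ℝ, E) 𝓘(ℝ, E') ∞ φ) (hp : p ∈ e.target)
    (hp' : φ (e.symm p) ∈ e'.source) (u v : E) :
    bilinSecondFF g h φ e e' p u v = bilinSecondFF g h φ e e' p v u := by
  rw [bilinSecondFF_apply, bilinSecondFF_apply, christoffel_symm g he hp u v,
    christoffel_symm (p := localMap φ e e' p) h he' (e'.map_source hp') (fderiv ℝ _ p u),
    fderiv_fderiv_localMap_symm he he' hφ hp hp' u v]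

/-- For an f-holomorphic map into a Kähler manifold,
`∇dφ(u, Fv) + dφ((∇_u F) v) = J ∇dφ(u, v)`. -/
theorem bilinSecondFF_localEnd (hF : SmoothEnd F) (hN : IsKahler h J) (he : e ∈ Charts E M)
    (he' : e' ∈ Charts E' N) (hφ : ContMDiff 𝓘(ℝ, E) 𝓘(ℝ, E') ∞ φ) (hhol : IsFHolomorphic F J φ)
    (hp : p ∈ e.target) (hp' : φ (e.symm p) ∈ e'.source) (u v : E) :
    bilinSecondFF g h φ e e' p u (localEnd F e p v)
        + fderiv ℝ (localMap φ e e') p (nablaEnd g F e p u v)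
      = localEnd J e' (localMap φ e e' p) (bilinSecondFF g h φ e e' p u v) := by
  have h1 := fderiv_fderiv_localMap hF hN.smooth he he' hφ hhol hp hp' u v
  -- ∇J = 0 trades the derivative of J along dφ(u) for the Christoffel terms of N contained in B.
  have h2 := nablaEnd_eq_zero_of_isKahler (p := localMap φ e e' p) h hN he' (e'.map_source hp')
    (fderiv ℝ (localMap φ e e') p u) (fderiv ℝ (localMap φ e e') p v)
  have hI := localEnd_fderiv_localMap he he' hφ hhol hp hp'
  rw [nablaEnd_apply, hI] at h2
  simp only [bilinSecondFF_apply, nablaEnd_apply, map_add, map_sub, hI]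
  rw [← sub_eq_zero] at h1 ⊢
  rw [← h1]
  rw [← sub_eq_zero, ← h2]
  abel

theorem localTension_eq_zero (hF : IsFStructure g F) (hmet : CondMet g F) (hsym : CondSym g F)
    (hN : IsKahler h J) (hφ : ContMDiff 𝓘(ℝ, E) 𝓘(ℝ, E') ∞ φ) (hhol : IsFHolomorphic F J φ)
    (he : e ∈ Charts E M) (he' : e' ∈ Charts E' N)
    (hp : p ∈ e.target) (hp' : φ (e.symm p) ∈ e'.source) : localTension g h φ e e' p = 0 := by
  have hB := bilinSecondFF_localEnd g h hF.smooth hN he he' hφ hhol hp hp'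
  have hS := bilinSecondFF_symm g h he he' hφ hp hp'
  have hI := localEnd_fderiv_localMap he he' hφ hhol hp hp'
  have hsq := localEnd_sq (p := localMap φ e e' p) hN.sq he' (e'.map_source hp')
  have hinj : ∀ w, localEnd J e' (localMap φ e e' p) w = 0 → w = 0 := fun w hw => by
    rw [← neg_eq_zero, ← hsq, hw, map_zero]
  have hcube := localEnd_cube hF.cube he hp
  have hquad : ∀ x, bilinSecondFF g h φ e e' p (localEnd F e p x) (localEnd F e p x)
      + bilinSecondFF g h φ e e' p (localEnd F e p (localEnd F e p x))
        (localEnd F e p (localEnd F e p x)) = 0 := by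
    intro x
    have h1 := map_add_eq_zero_of_closed (localMetric g e p) (localMetric_symm g p)
      (eq_zero_of_localMetric g he hp) (nablaEnd g F e p)
      (localMetric_nablaEnd g hF.smooth hF.skew he hp) (localEnd F e p)
      (localMetric_localEnd_left g hF.skew he hp) hcube
      (nablaEnd_cube g hF.smooth hF.cube he hp) (fun x z => by
        have h := localExtDeriv_eq_zero_of_condSym g hF hsym he hp x z
        rw [localExtDeriv_fundamentalForm g hF.smooth hF.skew he hp] at h
        linarith) x
    -- The vector w with Fw = 0 satisfies J dφ(w) = dφ(Fw) = 0, and J is injective.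
    have h2 := hinj _ ((hI _).trans (by rw [h1, map_zero]))
    set y := localEnd F e p x
    have h3 := hB (localEnd F e p y) y
    have h4 := congrArg (localEnd J e' (localMap φ e e' p)) (hB y y)
    rw [hsq, map_add, hI, hS y] at h4
    rw [map_add] at h2
    linear_combination (norm := module) h3 + h4 - h2
  refine sum_basis_sharp_eq_zero (Module.finBasis ℝ E) (localMetric g e p) (sharp g e p)
    (localMetric_sharp g he hp) (eq_zero_of_localMetric g he hp) (localEnd F e p)
    (localMetric_localEnd_left g hF.skew he hp) hcube (bilinSecondFF g h φ e e' p)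
    (fun u v hu hv => ?_) (fun u v => ?_)
  · have h1 := hB u v
    rw [hv, nablaEnd_eq_zero_of_condMet g hF hmet he hp hu hv, map_zero, map_zero, add_zero] at h1
    exact hinj _ h1.symm
  -- Polarization of the quadratic identity, using the symmetry of B.
  · have h1 := hquad (u + v)
    simp only [map_add, LinearMap.add_apply] at h1
    rw [hS (localEnd F e p v) (localEnd F e p u),
      hS (localEnd F e p (localEnd F e p v)) (localEnd F e p (localEnd F e p u))] at h1
    have h2 := hquad u
    have h3 := hquad v
    linear_combination (norm := module) (2⁻¹ : ℝ) • (h1 - h2 - h3)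

end Tension

end FStr

theorem mainTheorem7
    {E : Type*} [NormedAddCommGroup E] [NormedSpace ℝ E] [FiniteDimensional ℝ E]
    {M : Type*} [TopologicalSpace M] [ChartedSpace E M] [IsManifold 𝓘(ℝ, E) ∞ M]
    {E' : Type*} [NormedAddCommGroup E'] [NormedSpace ℝ E'] [FiniteDimensional ℝ E']
    {N : Type*} [TopologicalSpace N] [ChartedSpace E' N] [IsManifold 𝓘(ℝ, E') ∞ N]
    (g : FStr.Metric E M) (F : FStr.EndField E M)
    (hF : FStr.IsFStructure g F) (hint : FStr.IsIntegrable F)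
    (hmet : FStr.CondMet g F) (hsym : FStr.CondSym g F)
    (h : FStr.Metric E' N) (J : FStr.EndField E' N) (hN : FStr.IsKahler h J)
    (φ : M → N) (hφ : ContMDiff 𝓘(ℝ, E) 𝓘(ℝ, E') ∞ φ) (hhol : FStr.IsFHolomorphic F J φ) :
    FStr.IsHarmonic g h φ := by
  intro x e he hx e' he' hx'
  exact FStr.localTension_eq_zero g h hF hmet hsym hN hφ hhol he he' (e.map_source hx)
    (by rwa [e.left_inv hx])
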